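/- Let $F$ be a field of characteristic $0$ that is an extension of an ordered field $K$ (for example a subfield of $\mathbb R$), and let $l\ge 0$. Let $A=(a_{ij})$ be a Borcherds–Cartan matrix of size $l$ over $K$: $a_{ij}\le 0$ for $i\ne j$; $a_{ij}=0$ implies $a_{ji}=0$; and $2a_{ij}/a_{ii}\in\mathbb Z$ whenever $i\neq j$ and $a_{ii}>0$. Let $\mathfrak g$ be a rank $l$ Borcherds Lie algebra over $F$ with matrix $A$, standard Cartan subalgebra $\mathfrak h$ and Chevalley generators $e_1,\dots,e_l,f_1,\dots,f_l$. That is, there are nonzero simple coroots $h_i\in\mathfrak h$ and simple roots $\alpha_i\in\mathfrak h^*$ with $\alpha_j(h_i)=a_{ij}$ such that: * $\mathfrak h$ is an abelian subalgebra, and $\mathfrak g$ is generated by $\mathfrak h$, the $e_i$ and the $f_i$; * $[h,e_i]=\alpha_i(h)e_i$ and $[h,f_i]=-\alpha_i(h)f_i$ for $h\in\mathfrak h$, and $[e_i,f_j]=\delta_{ij}h_i$; * $(\operatorname{ad}e_i)^{1-2a_{ij}/a_{ii}}e_j=0=(\operatorname{ad}f_i)^{1-2a_{ij}/a_{ii}}f_j$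 if $i\ne j$ and $a_{ii}>0$, and $[e_i,e_j]=0=[f_i,f_j]$ if $a_{ij}=0$; * $\mathfrak g$ has a Lie algebra grading by $\mathbb Z^l$ in which $\mathfrak h$ lies in degree $0$, and $e_i$ and $f_i$ have degrees $\varepsilon_i$ and $-\varepsilon_i$, where $\varepsilon_1,\dots,\varepsilon_l$ is the standard basis of $\mathbb Z^l$. (Neither the $h_i$ nor the $\alpha_i$ need be linearly independent.) Let $\mathfrak g_+$ and $\mathfrak g_-$ be the subalgebras generated by $e_1,\dots,e_l$ and by $f_1,\dots,f_l$ respectively, let $\mathfrak h'=\mathfrak h\cap[\mathfrak g,\mathfrak g]$, and let $\mathfrak h''$ be any linear complement of $\mathfrak h'$ in $\mathfrak h$. For a subalgebra $\mathfrak s\subseteq\mathfrak g$, identify the universal enveloping algebra $U(\mathfrak s)$ with its image in $U(\mathfrak g)$; a product of subspaces of $U(\mathfrak g)$ is the linear span of the products of their elements. **Proposition 3.1.** For every partition $\{1,\dots,l\}=I\cup J$ into disjoint (possibly empty) subsets, $$U(\mathfrak g)=\Big(\prod_{i\in I}U(Fe_i)\Big)\,U(\mathfrak g_-)\,U(\mathfrak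 h'')\,U(\mathfrak g_+)\,\Big(\prod_{j\in J}U(Ff_j)\Big),$$ where the factors of each of the two products $\prod_{i\in I}$ and $\prod_{j\in J}$ may be taken in any order. -/

import Mathlib

/-- A Borcherds-Cartan matrix of size `l` over an ordered field `K`. No symmetrizability is assumed.
The matrices normalized by `A i i = 2` for `0 < A i i` and the symmetric real matrices are both
included. -/
structure IsBorcherdsCartanMatrix {K : Type*} [Field K] [LinearOrder K] {l : ℕ}
    (A : Matrix (Fin l) (Fin l) K) : Prop where
  offDiag_nonpos : ∀ i j, i ≠ j → A i j ≤ 0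
  zero_symm : ∀ i j, A i j = 0 → A j i = 0
  integrality : ∀ i j, i ≠ j → 0 < A i i → ∃ n : ℕ, 2 * A i j = -(n : K) * A i i

/-- The structure of a Borcherds Lie algebra (generalized Kac-Moody algebra) of rank `l`
with matrix `A` on the Lie algebra `g` over `F`: the standard Cartan subalgebra, the simple coroots
and simple roots, and the Chevalley generators `e i`, `f i`, subject to the Chevalley-Serre
relations, together with the formal root grading by `ℤ ^ l`.

The simple roots need not be linearly independent (so derived algebras are included) and neither
need the simple coroots (so quotients by central subspaces are included). Both the Lie algebra
presented by the Chevalley-Serre relations and its quotient by the largest graded ideal that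
meets the Cartan subalgebra trivially are covered. -/
structure BorcherdsLieAlgebra (F g : Type*) {K : Type*} [Field F] [LieRing g] [LieAlgebra F g]
    [Field K] [LinearOrder K] [Algebra K F] {l : ℕ} (A : Matrix (Fin l) (Fin l) K) where
  /-- the matrix is a Borcherds-Cartan matrix -/
  isBorcherdsCartan : IsBorcherdsCartanMatrix A
  /-- the standard Cartan subalgebra -/
  cartan : LieSubalgebra F g
  /-- the simple coroots `h i` -/
  coroot : Fin l → cartan
  /-- the simple roots `α i` -/
  root : Fin l → Module.Dual F cartan
  /-- the positive Chevalley generators -/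
  e : Fin l → g
  /-- the negative Chevalley generators -/
  f : Fin l → g
  coroot_ne_zero : ∀ i, coroot i ≠ 0
  root_coroot : ∀ i j, root j (coroot i) = algebraMap K F (A i j)
  /-- `g` is generated by the Cartan subalgebra and the Chevalley generators -/
  generate : LieSubalgebra.lieSpan F g ((cartan : Set g) ∪ Set.range e ∪ Set.range f) = ⊤
  cartan_abelian : ∀ x ∈ cartan, ∀ y ∈ cartan, ⁅x, y⁆ = 0
  lie_cartan_e : ∀ (x : cartan) (i : Fin l), ⁅(x : g), e i⁆ = root i x • e i
  lie_cartan_f : ∀ (x : cartan) (i : Fin l), ⁅(x : g), f i⁆ = -(root i x) • f i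
  lie_e_f_same : ∀ i, ⁅e i, f i⁆ = (coroot i : g)
  lie_e_f_ne : ∀ i j, i ≠ j → ⁅e i, f j⁆ = 0
  /-- `(ad e i) ^ (1 - 2 * A i j / A i i) (e j) = 0` when `0 < A i i` -/
  serre_e : ∀ i j, i ≠ j → 0 < A i i → ∀ n : ℕ, 2 * A i j = -(n : K) * A i i →
    ((LieAlgebra.ad F g (e i)) ^ (n + 1)) (e j) = 0
  serre_f : ∀ i j, i ≠ j → 0 < A i i → ∀ n : ℕ, 2 * A i j = -(n : K) * A i i →
    ((LieAlgebra.ad F g (f i)) ^ (n + 1)) (f j) = 0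
  orthogonal_e : ∀ i j, A i j = 0 → ⁅e i, e j⁆ = 0
  orthogonal_f : ∀ i j, A i j = 0 → ⁅f i, f j⁆ = 0
  /-- the formal root grading -/
  grading : (Fin l → ℤ) → Submodule F g
  grading_internal : DirectSum.IsInternal grading
  grading_bracket : SetLike.GradedBracket grading
  cartan_le_grading_zero : cartan.toSubmodule ≤ grading 0
  e_mem_grading : ∀ i, e i ∈ grading (Pi.single i 1)
  f_mem_grading : ∀ i, f i ∈ grading (-Pi.single i 1)

namespace BorcherdsLieAlgebra

variable {F g K : Type*} [Field F] [LieRing g] [LieAlgebra F g]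
    [Field K] [LinearOrder K] [Algebra K F] {l : ℕ} {A : Matrix (Fin l) (Fin l) K}

/-- The subalgebra `g₊` generated by the `e i`. -/
def plus (B : BorcherdsLieAlgebra F g A) : LieSubalgebra F g :=
  LieSubalgebra.lieSpan F g (Set.range B.e)

/-- The subalgebra `g₋` generated by the `f i`. -/
def minus (B : BorcherdsLieAlgebra F g A) : LieSubalgebra F g :=
  LieSubalgebra.lieSpan F g (Set.range B.f)

/-- `h' = h ∩ [g, g]`. -/
def cartanDerived (B : BorcherdsLieAlgebra F g A) : Submodule F g :=
  B.cartan.toSubmodule ⊓ (⁅(⊤ : LieIdeal F g), (⊤ : LieIdeal F g)⁆ : LieIdeal F g).toSubmodule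

/-- `c` is a complement of `h' = h ∩ [g, g]` in the Cartan subalgebra `h`, i.e. `h = c ⊕ h'`.
As `h` is abelian, every linear subspace of `h` is a Lie subalgebra. -/
def IsCartanComplement (B : BorcherdsLieAlgebra F g A) (c : LieSubalgebra F g) : Prop :=
  c.toSubmodule ⊓ B.cartanDerived = ⊥ ∧ c.toSubmodule ⊔ B.cartanDerived = B.cartan.toSubmodule

end BorcherdsLieAlgebra

/-- The line `F x` as a Lie subalgebra. -/
def lieLine (F : Type*) {g : Type*} [Field F] [LieRing g] [LieAlgebra F g] (x : g) :
    LieSubalgebra F g where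
  toSubmodule := Submodule.span F {x}
  lie_mem' := by
    intro a b ha hb
    obtain ⟨s, rfl⟩ := Submodule.mem_span_singleton.1 ha
    obtain ⟨t, rfl⟩ := Submodule.mem_span_singleton.1 hb
    simp

attribute [local instance 100] LieRing.ofAssociativeRing in
/-- `U(s)` as a linear subspace of `U(g)`, for a Lie subalgebra `s` of `g`: the image of the
homomorphism of enveloping algebras `U(s) → U(g)` that is induced by the inclusion. -/
noncomputable def envelopingSub (F : Type*) {g : Type*} [Field F] [LieRing g] [LieAlgebra F g]
    (s : LieSubalgebra F g) : Submodule F (UniversalEnvelopingAlgebra F g) :=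
  Subalgebra.toSubmodule
    (UniversalEnvelopingAlgebra.lift F ((UniversalEnvelopingAlgebra.ι F).comp s.incl)).range

/-!
The proof works inside `R = U(𝔤)` with the subalgebras generated by the images of the Chevalley
generators; no part of the Poincaré–Birkhoff–Witt theorem beyond the spanning statement is needed.
For a set `S ⊆ 𝔥` let `T(S) = U(𝔤₋) U(S) U(𝔤₊)` (`triangularProduct`). The spanning half of the
triangular decomposition gives `T(𝔥) = R` (`IsChevalleySystem.adjoinSub_le_triangularProduct`).

The heart of the matter is that `U(F eₖ) T(S) ⊇ T(S ∪ {hₖ})`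
(`IsChevalleySystem.triangularProduct_insert_le_left`): a line `F eₖ` put on the left supplies the
missing coroot `hₖ`. Let `N` be the subalgebra generated by all `(ad fₖ)ⁿ fⱼ` with `j ≠ k`. It is
normalized by `eₖ` and by `fₖ`, and `U(𝔤₋) = N · F[fₖ]`. For `x ∈ N` and `q` on the right,
`eₖ x fₖⁿ⁺¹ q = [eₖ, x] fₖⁿ⁺¹ q + x fₖⁿ⁺¹ eₖ q + (n + 1) x fₖⁿ hₖ q + d x fₖⁿ q`
with a scalar `d`, and in characteristic zero this can be solved for `x fₖⁿ hₖ q`. The right-hand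
version `T(S) U(F fₖ) ⊇ T(S ∪ {hₖ})` is the same statement in the opposite algebra.

Hence the product in question contains `T(𝔥'' ∪ {h₁, …, hₗ})`, in whatever order the lines are
multiplied. Finally `𝔥 ∩ [𝔤, 𝔤]` is spanned by the simple coroots
(`BorcherdsLieAlgebra.cartanDerived_le_corootSpan`): the sum `𝔤₋ + ∑ F hᵢ + 𝔤₊` is an ideal that
contains `[𝔤, 𝔤]`, and `𝔤₊`, `𝔤₋` have no component of degree zero. So `𝔥''` and the `hᵢ` together
span `𝔥`, and the product is everything.
-/

/-! ### Subalgebras as linear subspaces -/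

section Adjoin

variable (F : Type*) {R : Type*} [Field F] [Ring R] [Algebra F R]

/-- The subalgebra generated by `s`, viewed as a linear subspace, so that it can be multiplied with
other subspaces. -/
abbrev adjoinSub (s : Set R) : Submodule F R :=
  Subalgebra.toSubmodule (Algebra.adjoin F s)

variable {F}

theorem mem_adjoinSub_of_mem {s : Set R} {x : R} (hx : x ∈ s) : x ∈ adjoinSub F s :=
  Algebra.subset_adjoin hx

theorem adjoinSub_mul_mem {s : Set R} {W : Submodule F R} (hW : ∀ x ∈ s, ∀ w ∈ W, x * w ∈ W)
    {a w : R} (ha : a ∈ adjoinSub F s) (hw : w ∈ W) : a * w ∈ W := by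
  have ha' : a ∈ Algebra.adjoin F s := ha
  induction ha' using Algebra.adjoin_induction generalizing w with
  | mem x hx => exact hW x hx w hw
  | algebraMap r => rw [← Algebra.smul_def]; exact W.smul_mem r hw
  | add x y hx hy ihx ihy => rw [add_mul]; exact W.add_mem (ihx hx hw) (ihy hy hw)
  | mul x y hx hy ihx ihy => rw [mul_assoc]; exact ihx hx (ihy hy hw)

theorem adjoinSub_le_of_mul_mem {s : Set R} {W : Submodule F R} (h1 : (1 : R) ∈ W)
    (hW : ∀ x ∈ s, ∀ w ∈ W, x * w ∈ W) : adjoinSub F s ≤ W := fun a ha => by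
  simpa using adjoinSub_mul_mem hW ha h1

theorem mul_mem_mul_of_left {M N : Submodule F R} {x : R} (hM : ∀ m ∈ M, x * m ∈ M) {w : R}
    (hw : w ∈ M * N) : x * w ∈ M * N := by
  induction hw using Submodule.mul_induction_on' with
  | mem_mul_mem m hm n hn => rw [← mul_assoc]; exact Submodule.mul_mem_mul (hM m hm) hn
  | add a _ b _ iha ihb => rw [mul_add]; exact add_mem iha ihb

theorem one_mem_adjoinSub (s : Set R) : (1 : R) ∈ adjoinSub F s :=
  one_mem (Algebra.adjoin F s)

theorem mul_mem_adjoinSub {s : Set R} {x y : R} (hx : x ∈ adjoinSub F s) (hy : y ∈ adjoinSub F s) :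
    x * y ∈ adjoinSub F s :=
  mul_mem (S := Subalgebra F R) hx hy

theorem mul_mem_adjoinSub_mul {s : Set R} {Q : Submodule F R} {x w : R}
    (hx : x ∈ adjoinSub F s) (hw : w ∈ adjoinSub F s * Q) : x * w ∈ adjoinSub F s * Q :=
  mul_mem_mul_of_left (fun _ hm => mul_mem_adjoinSub hx hm) hw

theorem mem_adjoinSub_mul {s : Set R} {Q : Submodule F R} {q : R} (hq : q ∈ Q) :
    q ∈ adjoinSub F s * Q := by
  simpa using Submodule.mul_mem_mul (one_mem_adjoinSub (F := F) s) hq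

/-- To see that left multiplication by `x` preserves `adjoinSub F s * Q`, it is enough to move `x`
past one generator at a time. -/
theorem mul_mem_of_step {s : Set R} {x : R} {Q : Submodule F R}
    (hQ : ∀ q ∈ Q, x * q ∈ adjoinSub F s * Q)
    (hs : ∀ y ∈ s, ∀ w ∈ adjoinSub F s * Q, x * w ∈ adjoinSub F s * Q →
      x * (y * w) ∈ adjoinSub F s * Q) {w : R}
    (hw : w ∈ adjoinSub F s * Q) : x * w ∈ adjoinSub F s * Q := by
  set W : Submodule F R := adjoinSub F s * Q ⊓ (adjoinSub F s * Q).comap (LinearMap.mulLeft F x)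
    with hW
  have hle : adjoinSub F s * Q ≤ W := by
    rw [Submodule.mul_le]
    intro y hy q hq
    refine adjoinSub_mul_mem ?_ hy ⟨mem_adjoinSub_mul hq, hQ q hq⟩
    rintro y hy w ⟨hw1, hw2⟩
    exact ⟨mul_mem_adjoinSub_mul (mem_adjoinSub_of_mem hy) hw1, hs y hy w hw1 hw2⟩
  exact (hle hw).2

/-- If the generators `s` are eigenvectors for the commutator with `x`, then left multiplication by
`x` can be moved past the subalgebra generated by `s`. -/
theorem mul_mem_of_weight {s : Set R} {x : R} {Q : Submodule F R}
    (hs : ∀ y ∈ s, ∃ c : F, x * y = y * x + c • y) (hQ : ∀ q ∈ Q, x * q ∈ Q) {w : R}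
    (hw : w ∈ adjoinSub F s * Q) : x * w ∈ adjoinSub F s * Q := by
  refine mul_mem_of_step (fun q hq => mem_adjoinSub_mul (hQ q hq)) (fun y hy w hw1 hw2 => ?_) hw
  obtain ⟨c, hc⟩ := hs y hy
  rw [← mul_assoc, hc, add_mul, mul_assoc, smul_mul_assoc]
  have hy' := mem_adjoinSub_of_mem (F := F) hy
  exact add_mem (mul_mem_adjoinSub_mul hy' hw2)
    (Submodule.smul_mem _ _ (mul_mem_adjoinSub_mul hy' hw1))

theorem adjoinSub_insert_le {s : Set R} {x : R} (hs : ∀ y ∈ s, Commute x y) :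
    adjoinSub F (insert x s) ≤ adjoinSub F {x} * adjoinSub F s := by
  refine adjoinSub_le_of_mul_mem (mem_adjoinSub_mul (one_mem_adjoinSub s)) ?_
  rintro y (rfl | hy) w hw
  · exact mul_mem_adjoinSub_mul (mem_adjoinSub_of_mem (Set.mem_singleton _)) hw
  · refine mul_mem_of_weight ?_ (fun m hm => mul_mem_adjoinSub (mem_adjoinSub_of_mem hy) hm) hw
    rintro z rfl
    exact ⟨0, by simpa using (hs y hy).eq.symm⟩

/-- A commutator that maps the generators of a subalgebra into it maps the subalgebra into
itself. -/
theorem commutator_mem_adjoinSub {s : Set R} {x : R}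
    (hs : ∀ y ∈ s, x * y - y * x ∈ adjoinSub F s) {y : R} (hy : y ∈ adjoinSub F s) :
    x * y - y * x ∈ adjoinSub F s := by
  replace hy : y ∈ Algebra.adjoin F s := hy
  induction hy using Algebra.adjoin_induction with
  | mem y hy => exact hs y hy
  | algebraMap r => rw [Algebra.commutes r x, sub_self]; exact zero_mem _
  | add y z hy hz ihy ihz =>
    have : x * (y + z) - (y + z) * x = (x * y - y * x) + (x * z - z * x) := by noncomm_ring
    rw [this]
    exact add_mem ihy ihz
  | mul y z hy hz ihy ihz =>
    have : x * (y * z) - y * z * x = (x * y - y * x) * z + y * (x * z - z * x) := by noncomm_ring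
    rw [this]
    exact add_mem (mul_mem_adjoinSub ihy hz) (mul_mem_adjoinSub hy ihz)

theorem map_op_adjoinSub (s : Set R) :
    (adjoinSub F s).map (MulOpposite.opLinearEquiv F : R ≃ₗ[F] Rᵐᵒᵖ).toLinearMap =
      adjoinSub F (MulOpposite.op '' s) := by
  have h := Subalgebra.op_adjoin (R := F) s
  have himg : MulOpposite.op '' s = MulOpposite.unop ⁻¹' s :=
    MulOpposite.opEquiv.image_eq_preimage_symm s
  rw [himg, adjoinSub, adjoinSub, ← h]
  ext x
  simp only [Submodule.mem_map, Subalgebra.mem_toSubmodule, Subalgebra.mem_op]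
  exact ⟨by rintro ⟨y, hy, rfl⟩; exact hy, fun hx => ⟨x.unop, hx, rfl⟩⟩

end Adjoin

/-! ### Chevalley systems in associative algebras -/

/-- The relations, in an associative algebra, of a set `H` of commuting elements and Chevalley
generators `e i`, `f i` that are eigenvectors for the commutator with each element of `H`, with
`e i * f j - f j * e i = δ i j * h i`. The eigenvalues on `e i` and on `f i` are not required to be
opposite; this keeps the definition symmetric under passage to the opposite algebra. -/
structure IsChevalleySystem (F : Type*) {R ι : Type*} [Field F] [Ring R] [Algebra F R]
    (H : Set R) (h e f : ι → R) : Prop where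
  commute : ∀ x ∈ H, ∀ y ∈ H, Commute x y
  coroot_mem : ∀ i, h i ∈ H
  weight_e : ∀ x ∈ H, ∀ i, ∃ c : F, x * e i = e i * x + c • e i
  weight_f : ∀ x ∈ H, ∀ i, ∃ c : F, x * f i = f i * x + c • f i
  e_mul_f : ∀ i, e i * f i = f i * e i + h i
  e_mul_f_ne : ∀ i j, i ≠ j → e i * f j = f j * e i

/-- The product `U(𝔤₋) U(S) U(𝔤₊)` for a set `S` of elements of the Cartan subalgebra. -/
def triangularProduct (F : Type*) {R ι : Type*} [Field F] [Ring R] [Algebra F R]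
    (e f : ι → R) (S : Set R) : Submodule F R :=
  adjoinSub F (Set.range f) * (adjoinSub F S * adjoinSub F (Set.range e))

theorem map_op_triangularProduct {F R ι : Type*} [Field F] [Ring R] [Algebra F R]
    (e f : ι → R) (S : Set R) :
    (triangularProduct F e f S).map (MulOpposite.opLinearEquiv F : R ≃ₗ[F] Rᵐᵒᵖ).toLinearMap =
      triangularProduct F (MulOpposite.op ∘ f) (MulOpposite.op ∘ e) (MulOpposite.op '' S) := by
  have hmul : ∀ M N : Submodule F R,
      (M * N).map (MulOpposite.opLinearEquiv F : R ≃ₗ[F] Rᵐᵒᵖ).toLinearMap =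
        N.map (MulOpposite.opLinearEquiv F : R ≃ₗ[F] Rᵐᵒᵖ).toLinearMap *
          M.map (MulOpposite.opLinearEquiv F : R ≃ₗ[F] Rᵐᵒᵖ).toLinearMap :=
    Submodule.map_op_mul
  simp only [triangularProduct, hmul, map_op_adjoinSub, Set.range_comp, mul_assoc]

namespace IsChevalleySystem

variable {F R ι : Type*} [Field F] [Ring R] [Algebra F R] {H : Set R} {h e f : ι → R}

theorem op (C : IsChevalleySystem F H h e f) :
    IsChevalleySystem F (MulOpposite.op '' H) (MulOpposite.op ∘ h) (MulOpposite.op ∘ f)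
      (MulOpposite.op ∘ e) where
  commute := by
    rintro _ ⟨x, hx, rfl⟩ _ ⟨y, hy, rfl⟩
    exact (C.commute x hx y hy).op
  coroot_mem i := ⟨_, C.coroot_mem i, rfl⟩
  weight_e := by
    rintro _ ⟨x, hx, rfl⟩ i
    obtain ⟨c, hc⟩ := C.weight_f x hx i
    refine ⟨-c, ?_⟩
    simp only [Function.comp_apply, ← MulOpposite.op_mul, ← MulOpposite.op_smul,
      ← MulOpposite.op_add, hc]
    simp
  weight_f := by
    rintro _ ⟨x, hx, rfl⟩ i
    obtain ⟨c, hc⟩ := C.weight_e x hx i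
    refine ⟨-c, ?_⟩
    simp only [Function.comp_apply, ← MulOpposite.op_mul, ← MulOpposite.op_smul,
      ← MulOpposite.op_add, hc]
    simp
  e_mul_f i := by
    simp only [Function.comp_apply, ← MulOpposite.op_mul, ← MulOpposite.op_add, C.e_mul_f]
  e_mul_f_ne i j hij := by
    simp only [Function.comp_apply, ← MulOpposite.op_mul, C.e_mul_f_ne j i hij.symm]

/-- `U(S) U(𝔤₊)` is stable under left multiplication by each `e i`. -/
theorem e_mul_mem (C : IsChevalleySystem F H h e f) {S : Set R} (hS : S ⊆ H) (i : ι) {w : R}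
    (hw : w ∈ adjoinSub F S * adjoinSub F (Set.range e)) :
    e i * w ∈ adjoinSub F S * adjoinSub F (Set.range e) := by
  refine mul_mem_of_step (fun q hq => mem_adjoinSub_mul
    (mul_mem_adjoinSub (mem_adjoinSub_of_mem (Set.mem_range_self i)) hq))
    (fun x hx w _ hw2 => ?_) hw
  obtain ⟨c, hc⟩ := C.weight_e x (hS hx) i
  have : e i * (x * w) = x * (e i * w) - c • (e i * w) := by
    rw [← mul_assoc, ← mul_assoc, hc]; simp [add_mul]
  rw [this]
  exact sub_mem (mul_mem_adjoinSub_mul (mem_adjoinSub_of_mem hx) hw2) (Submodule.smul_mem _ _ hw2)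

/-- The triangular decomposition: the product `U(𝔤₋) U(𝔥) U(𝔤₊)` contains the subalgebra generated
by `𝔥` and the Chevalley generators. -/
theorem adjoinSub_le_triangularProduct (C : IsChevalleySystem F H h e f) :
    adjoinSub F (H ∪ Set.range e ∪ Set.range f) ≤ triangularProduct F e f H := by
  have hf : ∀ i, ∀ w ∈ triangularProduct F e f H, f i * w ∈ triangularProduct F e f H :=
    fun i w hw => mul_mem_adjoinSub_mul (mem_adjoinSub_of_mem (Set.mem_range_self i)) hw
  have hH : ∀ x ∈ H, ∀ w ∈ triangularProduct F e f H, x * w ∈ triangularProduct F e f H := by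
    intro x hx w hw
    refine mul_mem_of_weight ?_
      (fun q hq => mul_mem_adjoinSub_mul (mem_adjoinSub_of_mem hx) hq) hw
    rintro _ ⟨i, rfl⟩
    exact C.weight_f x hx i
  refine adjoinSub_le_of_mul_mem ?_ ?_
  · exact mem_adjoinSub_mul (mem_adjoinSub_mul (one_mem_adjoinSub _))
  · rintro x ((hx | ⟨i, rfl⟩) | ⟨i, rfl⟩)
    · exact hH x hx
    · refine fun w hw => mul_mem_of_step
        (fun q hq => mem_adjoinSub_mul (C.e_mul_mem subset_rfl i hq)) ?_ hw
      rintro _ ⟨j, rfl⟩ w hw1 hw2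
      rw [← mul_assoc (e i)]
      rcases eq_or_ne i j with rfl | hij
      · rw [C.e_mul_f, add_mul, mul_assoc]
        exact add_mem (hf i _ hw2) (hH _ (C.coroot_mem i) _ hw1)
      · rw [C.e_mul_f_ne i j hij, mul_assoc]
        exact hf j _ hw2
    · exact hf i

/-- `e i * f i ^ (n + 1)` modulo lower terms: the coefficient `n + 1` of `f i ^ n * h i` is what
requires characteristic zero. -/
theorem e_mul_f_pow (C : IsChevalleySystem F H h e f) (i : ι) (n : ℕ) :
    ∃ d : F, e i * f i ^ (n + 1) =
      f i ^ (n + 1) * e i + ((n : F) + 1) • (f i ^ n * h i) + d • f i ^ n := by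
  obtain ⟨c, hc⟩ := C.weight_f _ (C.coroot_mem i) i
  induction n with
  | zero => exact ⟨0, by simp [C.e_mul_f]⟩
  | succ n ih =>
    obtain ⟨d, hd⟩ := ih
    refine ⟨((n : F) + 1) * c + d, ?_⟩
    have h1 : e i * f i ^ (n + 1 + 1) = e i * f i ^ (n + 1) * f i := by rw [pow_succ, mul_assoc]
    have h2 : f i ^ (n + 1) * e i * f i =
        f i ^ (n + 1 + 1) * e i + f i ^ (n + 1) * h i := by
      rw [mul_assoc, C.e_mul_f, mul_add, ← mul_assoc, ← pow_succ]
    have h3 : f i ^ n * h i * f i = f i ^ (n + 1) * h i + c • f i ^ (n + 1) := by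
      rw [mul_assoc, hc, mul_add, ← mul_assoc, ← pow_succ, mul_smul_comm, ← pow_succ]
    rw [h1, hd, add_mul, add_mul, h2, smul_mul_assoc, h3, smul_mul_assoc, ← pow_succ]
    push_cast
    module

theorem e_pow_mul_coroot (C : IsChevalleySystem F H h e f) (i : ι) (n : ℕ) :
    ∃ d : F, e i ^ n * h i = h i * e i ^ n + d • e i ^ n := by
  obtain ⟨c, hc⟩ := C.weight_e _ (C.coroot_mem i) i
  induction n with
  | zero => exact ⟨0, by simp⟩
  | succ n ih =>
    obtain ⟨d, hd⟩ := ih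
    refine ⟨d - c, ?_⟩
    have : e i * h i = h i * e i - c • e i := by rw [hc]; simp
    rw [pow_succ, mul_assoc, this, mul_sub, ← mul_assoc, hd, mul_smul_comm, ← pow_succ, add_mul,
      smul_mul_assoc, mul_assoc, ← pow_succ]
    module

/-- The elements `(ad (f k)) ^ n (f j)` with `j ≠ k`. The subalgebra that they generate plays the
role of the enveloping algebra of the ideal of `𝔤₋` generated by the `f j` with `j ≠ k`. -/
def adStrings (F : Type*) {R ι : Type*} [Field F] [Ring R] [Algebra F R] (f : ι → R) (k : ι) :
    Set R :=
  {x | ∃ j, j ≠ k ∧ ∃ n : ℕ,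
    ((LinearMap.mulLeft F (f k) - LinearMap.mulRight F (f k)) ^ n) (f j) = x}

theorem f_commutator_adStrings (f : ι → R) (k : ι) {y : R} (hy : y ∈ adStrings F f k) :
    f k * y - y * f k ∈ adStrings F f k := by
  obtain ⟨j, hj, n, rfl⟩ := hy
  exact ⟨j, hj, n + 1, by rw [pow_succ']; simp⟩

theorem adjoinSub_adStrings_le (f : ι → R) (k : ι) :
    adjoinSub F (adStrings F f k) ≤ adjoinSub F (Set.range f) := by
  refine adjoinSub_le_of_mul_mem (one_mem_adjoinSub _) ?_
  rintro _ ⟨j, -, n, rfl⟩ w hw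
  refine mul_mem_adjoinSub ?_ hw
  induction n with
  | zero => exact mem_adjoinSub_of_mem (Set.mem_range_self j)
  | succ n ih =>
    have hk : f k ∈ adjoinSub F (Set.range f) := mem_adjoinSub_of_mem (Set.mem_range_self k)
    rw [pow_succ']
    exact sub_mem (mul_mem_adjoinSub hk ih) (mul_mem_adjoinSub ih hk)

theorem adjoinSub_range_le (f : ι → R) (k : ι) :
    adjoinSub F (Set.range f) ≤ adjoinSub F (adStrings F f k) * adjoinSub F {f k} := by
  refine adjoinSub_le_of_mul_mem (mem_adjoinSub_mul (one_mem_adjoinSub _)) ?_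
  rintro _ ⟨j, rfl⟩ w hw
  rcases eq_or_ne j k with rfl | hj
  · refine mul_mem_of_step (fun q hq => mem_adjoinSub_mul
      (mul_mem_adjoinSub (mem_adjoinSub_of_mem (Set.mem_singleton _)) hq))
      (fun y hy w hw1 hw2 => ?_) hw
    have : f j * (y * w) = y * (f j * w) + (f j * y - y * f j) * w := by noncomm_ring
    rw [this]
    exact add_mem (mul_mem_adjoinSub_mul (mem_adjoinSub_of_mem hy) hw2)
      (mul_mem_adjoinSub_mul (mem_adjoinSub_of_mem (f_commutator_adStrings f j hy)) hw1)
  · exact mul_mem_adjoinSub_mul (mem_adjoinSub_of_mem ⟨j, hj, 0, by simp⟩) hw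

theorem coroot_commutator_adStrings (C : IsChevalleySystem F H h e f) (k j : ι) (n : ℕ) :
    ∃ c : F,
      h k * ((LinearMap.mulLeft F (f k) - LinearMap.mulRight F (f k)) ^ n) (f j) -
        ((LinearMap.mulLeft F (f k) - LinearMap.mulRight F (f k)) ^ n) (f j) * h k =
      c • ((LinearMap.mulLeft F (f k) - LinearMap.mulRight F (f k)) ^ n) (f j) := by
  induction n with
  | zero =>
    obtain ⟨c, hc⟩ := C.weight_f _ (C.coroot_mem k) j
    exact ⟨c, by simp [hc]⟩
  | succ n ih =>
    obtain ⟨c, hc⟩ := ih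
    obtain ⟨a, ha⟩ := C.weight_f _ (C.coroot_mem k) k
    refine ⟨a + c, ?_⟩
    rw [pow_succ']
    simp only [Module.End.mul_apply, LinearMap.sub_apply, LinearMap.mulLeft_apply,
      LinearMap.mulRight_apply]
    set z := ((LinearMap.mulLeft F (f k) - LinearMap.mulRight F (f k)) ^ n) (f j)
    have ha' : h k * f k - f k * h k = a • f k := by rw [ha]; simp
    have : h k * (f k * z - z * f k) - (f k * z - z * f k) * h k =
        (h k * f k - f k * h k) * z + f k * (h k * z - z * h k) - (h k * z - z * h k) * f k
          - z * (h k * f k - f k * h k) := by noncomm_ring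
    rw [this, ha', hc]
    simp only [smul_mul_assoc, mul_smul_comm]
    module

/-- The commutator with `e k` preserves the subalgebra generated by the strings
`(ad (f k)) ^ n (f j)`, `j ≠ k`. -/
theorem e_commutator_mem (C : IsChevalleySystem F H h e f) (k : ι) {y : R}
    (hy : y ∈ adjoinSub F (adStrings F f k)) :
    e k * y - y * e k ∈ adjoinSub F (adStrings F f k) := by
  refine commutator_mem_adjoinSub ?_ hy
  rintro _ ⟨j, hj, n, rfl⟩
  induction n with
  | zero => simp [C.e_mul_f_ne k j hj.symm]
  | succ n ih =>
    obtain ⟨c, hc⟩ := C.coroot_commutator_adStrings k j n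
    have hz : ((LinearMap.mulLeft F (f k) - LinearMap.mulRight F (f k)) ^ n) (f j) ∈
        adjoinSub F (adStrings F f k) := mem_adjoinSub_of_mem ⟨j, hj, n, rfl⟩
    rw [pow_succ']
    simp only [Module.End.mul_apply, LinearMap.sub_apply, LinearMap.mulLeft_apply,
      LinearMap.mulRight_apply]
    set z := ((LinearMap.mulLeft F (f k) - LinearMap.mulRight F (f k)) ^ n) (f j)
    have hef : e k * f k - f k * e k = h k := by rw [C.e_mul_f]; simp
    have : e k * (f k * z - z * f k) - (f k * z - z * f k) * e k =
        (e k * f k - f k * e k) * z - z * (e k * f k - f k * e k) +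
          (f k * (e k * z - z * e k) - (e k * z - z * e k) * f k) := by noncomm_ring
    rw [this, hef, hc]
    exact add_mem (Submodule.smul_mem _ _ hz) (commutator_mem_adjoinSub
      (fun y hy => mem_adjoinSub_of_mem (f_commutator_adStrings f k hy)) ih)

/-- The rank one step, with `M` in the role of `U(F e k) U(𝔤₋) Q` for a subspace `Q` that is stable
under left multiplication by `e k`. -/
theorem mul_coroot_mul_mem [CharZero F] (C : IsChevalleySystem F H h e f) (k : ι)
    {M : Submodule F R} (hM : ∀ m ∈ M, e k * m ∈ M) {q : R}
    (hq : ∀ y ∈ adjoinSub F (Set.range f), y * q ∈ M)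
    (heq : ∀ y ∈ adjoinSub F (Set.range f), y * (e k * q) ∈ M) {y : R}
    (hy : y ∈ adjoinSub F (Set.range f)) : y * (h k * q) ∈ M := by
  have hfk : ∀ n, f k ^ n ∈ adjoinSub F (Set.range f) := fun n =>
    (Algebra.adjoin F (Set.range f)).pow_mem (Algebra.subset_adjoin (Set.mem_range_self k)) n
  have hpow : ∀ x ∈ adjoinSub F (adStrings F f k), ∀ n : ℕ, x * f k ^ n * (h k * q) ∈ M := by
    intro x hx n
    have hx' := adjoinSub_adStrings_le f k hx
    obtain ⟨d, hd⟩ := C.e_mul_f_pow k n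
    -- Solve `e k * x * f k ^ (n + 1) * q ∈ M` for the term with the factor `n + 1`.
    have hn : ((n : F) + 1) ≠ 0 := by exact_mod_cast n.succ_ne_zero
    have key : ((n : F) + 1) • (x * f k ^ n * (h k * q)) =
        e k * (x * f k ^ (n + 1) * q) - (e k * x - x * e k) * f k ^ (n + 1) * q
          - x * f k ^ (n + 1) * (e k * q) - d • (x * f k ^ n * q) := by
      have h1 : e k * (x * f k ^ (n + 1) * q) - (e k * x - x * e k) * f k ^ (n + 1) * q =
          x * (e k * f k ^ (n + 1)) * q := by noncomm_ring
      rw [h1, hd]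
      simp only [mul_add, add_mul, smul_mul_assoc, mul_smul_comm, mul_assoc]
      abel
    rw [← Submodule.smul_mem_iff M hn, key]
    refine sub_mem (sub_mem (sub_mem ?_ ?_) ?_) (Submodule.smul_mem _ _ ?_)
    · exact hM _ (hq _ (mul_mem_adjoinSub hx' (hfk _)))
    · exact hq _ (mul_mem_adjoinSub (adjoinSub_adStrings_le f k (C.e_commutator_mem k hx)) (hfk _))
    · exact heq _ (mul_mem_adjoinSub hx' (hfk _))
    · exact hq _ (mul_mem_adjoinSub hx' (hfk _))
  have hle : adjoinSub F (adStrings F f k) * adjoinSub F {f k} ≤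
      M.comap (LinearMap.mulRight F (h k * q)) := by
    rw [Submodule.mul_le]
    intro x hx z hz
    have hz' : z ∈ Algebra.adjoin F {f k} := hz
    rw [Algebra.adjoin_singleton_eq_range_aeval] at hz'
    obtain ⟨p, rfl⟩ := hz'
    change x * Polynomial.aeval (f k) p * (h k * q) ∈ M
    rw [Polynomial.aeval_eq_sum_range, Finset.mul_sum, Finset.sum_mul]
    refine sum_mem fun n _ => ?_
    rw [mul_smul_comm, smul_mul_assoc]
    exact Submodule.smul_mem _ _ (hpow x hx n)
  exact hle (adjoinSub_range_le f k hy)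

/-- Multiplying the triangular product on the left by `U(F e k)` produces the coroot `h k`. -/
theorem triangularProduct_insert_le_left [CharZero F] (C : IsChevalleySystem F H h e f) (k : ι)
    {S : Set R} (hS : S ⊆ H) :
    triangularProduct F e f (insert (h k) S) ≤ adjoinSub F {e k} * triangularProduct F e f S := by
  set M := adjoinSub F {e k} * triangularProduct F e f S with hMdef
  have hM : ∀ m ∈ M, e k * m ∈ M := fun m hm =>
    mul_mem_adjoinSub_mul (mem_adjoinSub_of_mem (Set.mem_singleton _)) hm
  -- `V` is the largest subspace with `e k * V ⊆ V` and `U(𝔤₋) V ⊆ M`.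
  let V : Submodule F R := ⨅ n : ℕ, ⨅ y : adjoinSub F (Set.range f),
    M.comap (LinearMap.mulLeft F (y : R) ∘ₗ LinearMap.mulLeft F (e k ^ n))
  have hV : ∀ {q : R}, q ∈ V ↔
      ∀ n : ℕ, ∀ y ∈ adjoinSub F (Set.range f), y * (e k ^ n * q) ∈ M := by
    intro q; simp [V, Submodule.mem_iInf]
  have hVe : ∀ q ∈ V, e k * q ∈ V := fun q hq => hV.2 fun n y hy => by
    have := hV.1 hq (n + 1) y hy
    rwa [pow_succ, mul_assoc] at this
  have hVh : ∀ q ∈ V, ∀ y ∈ adjoinSub F (Set.range f), y * (h k * q) ∈ M := fun q hq y hy =>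
    C.mul_coroot_mul_mem k hM (fun y hy => by simpa using hV.1 hq 0 y hy)
      (fun y hy => by simpa using hV.1 hq 1 y hy) hy
  have hVepow : ∀ n : ℕ, ∀ q ∈ V, e k ^ n * q ∈ V := by
    intro n q hq
    induction n with
    | zero => simpa using hq
    | succ n ih => rw [pow_succ', mul_assoc]; exact hVe _ ih
  have hVcoroot : ∀ q ∈ V, h k * q ∈ V := fun q hq => hV.2 fun n y hy => by
    obtain ⟨d, hd⟩ := C.e_pow_mul_coroot k n
    have : y * (e k ^ n * (h k * q)) = y * (h k * (e k ^ n * q)) + d • (y * (e k ^ n * q)) := by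
      rw [← mul_assoc (e k ^ n), hd]; simp [add_mul, mul_add, mul_assoc]
    rw [this]
    exact add_mem (hVh _ (hVepow n q hq) y hy) (Submodule.smul_mem _ _ (hV.1 hq n y hy))
  have hQV : adjoinSub F S * adjoinSub F (Set.range e) ≤ V := fun q hq => hV.2 fun n y hy => by
    have hq' : e k ^ n * q ∈ adjoinSub F S * adjoinSub F (Set.range e) := by
      induction n with
      | zero => simpa using hq
      | succ n ih => rw [pow_succ', mul_assoc]; exact C.e_mul_mem hS k ih
    exact mem_adjoinSub_mul (Submodule.mul_mem_mul hy hq')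
  have hcomm : ∀ y ∈ S, Commute (h k) y := fun y hy => C.commute _ (C.coroot_mem k) y (hS hy)
  rw [triangularProduct, Submodule.mul_le]
  intro y hy q hq
  have hq' : q ∈ adjoinSub F {h k} * (adjoinSub F S * adjoinSub F (Set.range e)) := by
    rw [← mul_assoc]
    exact mul_le_mul_left (adjoinSub_insert_le hcomm) _ hq
  have hqV : q ∈ V := by
    refine (Submodule.mul_le.2 fun a ha b hb => ?_ : _ ≤ V) hq'
    refine adjoinSub_mul_mem ?_ ha (hQV hb)
    rintro _ rfl
    exact hVcoroot
  simpa using hV.1 hqV 0 y hy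

/-- Multiplying the triangular product on the right by `U(F f k)` produces the coroot `h k`; this
is the left-hand version in the opposite algebra, where `e` and `f` exchange their roles. -/
theorem triangularProduct_insert_le_right [CharZero F] (C : IsChevalleySystem F H h e f) (k : ι)
    {S : Set R} (hS : S ⊆ H) :
    triangularProduct F e f (insert (h k) S) ≤ triangularProduct F e f S * adjoinSub F {f k} := by
  have hop := C.op.triangularProduct_insert_le_left k (Set.image_mono (f := MulOpposite.op) hS)
  have hinj := Submodule.map_le_map_iff_of_injective
    (f := (MulOpposite.opLinearEquiv F : R ≃ₗ[F] Rᵐᵒᵖ).toLinearMap) (LinearEquiv.injective _)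
  rw [← hinj]
  have hmul := Submodule.map_op_mul (triangularProduct F e f S) (adjoinSub F {f k})
  rw [map_op_triangularProduct]
  refine le_of_le_of_eq ?_ hmul.symm
  rw [map_op_triangularProduct, map_op_adjoinSub, Set.image_singleton, Set.image_insert_eq]
  exact hop

end IsChevalleySystem

/-! ### Products over lists of simple roots -/

theorem image_mem_cons {ι R : Type*} (h : ι → R) (i : ι) (o : List ι) :
    h '' {j | j ∈ i :: o} = insert (h i) (h '' {j | j ∈ o}) := by
  rw [← Set.image_insert_eq]
  congr 1
  ext j
  exact List.mem_cons

namespace IsChevalleySystem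

variable {F R ι : Type*} [Field F] [CharZero F] [Ring R] [Algebra F R] {H : Set R} {h e f : ι → R}

theorem triangularProduct_union_le_left (C : IsChevalleySystem F H h e f) {S : Set R}
    (hS : S ⊆ H) (o : List ι) :
    triangularProduct F e f (S ∪ h '' {i | i ∈ o}) ≤
      (o.map fun i => adjoinSub F {e i}).prod * triangularProduct F e f S := by
  induction o with
  | nil => simp
  | cons i o ih =>
    have hset : S ∪ h '' {j | j ∈ i :: o} = insert (h i) (S ∪ h '' {j | j ∈ o}) := by
      rw [image_mem_cons, Set.union_insert]
    have hsub : S ∪ h '' {j | j ∈ o} ⊆ H :=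
      Set.union_subset hS (by rintro _ ⟨j, -, rfl⟩; exact C.coroot_mem j)
    rw [hset, List.map_cons, List.prod_cons, mul_assoc]
    exact (C.triangularProduct_insert_le_left i hsub).trans (mul_le_mul_right ih _)

theorem triangularProduct_union_le_right (C : IsChevalleySystem F H h e f) {S : Set R}
    (hS : S ⊆ H) (o : List ι) :
    triangularProduct F e f (S ∪ h '' {i | i ∈ o}) ≤
      triangularProduct F e f S * (o.map fun i => adjoinSub F {f i}).prod := by
  induction o generalizing S with
  | nil => simp
  | cons i o ih =>
    have hset : S ∪ h '' {j | j ∈ i :: o} = insert (h i) S ∪ h '' {j | j ∈ o} := by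
      rw [image_mem_cons, Set.union_insert, Set.insert_union]
    rw [hset, List.map_cons, List.prod_cons, ← mul_assoc]
    exact (ih (Set.insert_subset (C.coroot_mem i) hS)).trans
      (mul_le_mul_left (C.triangularProduct_insert_le_right i hS) _)

end IsChevalleySystem

/-! ### The Cartan subalgebra and the derived algebra -/

section LieSpan

variable {F L : Type*} [Field F] [LieRing L] [LieAlgebra F L]

/-- A subspace that is stable under bracketing with generators of a Lie algebra is an ideal. -/
theorem lie_mem_of_generators {s : Set L} (hs : LieSubalgebra.lieSpan F L s = ⊤)
    {W : Submodule F L} (hW : ∀ x ∈ s, ∀ w ∈ W, ⁅x, w⁆ ∈ W) (x : L) {w : L} (hw : w ∈ W) :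
    ⁅x, w⁆ ∈ W := by
  have hx : x ∈ LieSubalgebra.lieSpan F L s := hs ▸ LieSubalgebra.mem_top x
  induction hx using LieSubalgebra.lieSpan_induction generalizing w with
  | mem x hx => exact hW x hx w hw
  | zero => simp
  | add x y _ _ ihx ihy => rw [add_lie]; exact add_mem (ihx hw) (ihy hw)
  | smul a x _ ih => rw [smul_lie]; exact W.smul_mem a (ih hw)
  | lie x y _ _ ihx ihy => rw [lie_lie]; exact sub_mem (ihx (ihy hw)) (ihy (ihx hw))

/-- If a derivation `ad x` maps generators of a Lie subalgebra into it, it preserves it. -/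
theorem lie_mem_lieSpan {s : Set L} {x : L}
    (hs : ∀ y ∈ s, ⁅x, y⁆ ∈ LieSubalgebra.lieSpan F L s) {y : L}
    (hy : y ∈ LieSubalgebra.lieSpan F L s) : ⁅x, y⁆ ∈ LieSubalgebra.lieSpan F L s := by
  induction hy using LieSubalgebra.lieSpan_induction with
  | mem y hy => exact hs y hy
  | zero => simp
  | add y z _ _ ihy ihz => rw [lie_add]; exact add_mem ihy ihz
  | smul a y _ ih => rw [lie_smul]; exact LieSubalgebra.smul_mem _ a ih
  | lie y z hy hz ihy ihz =>
    rw [leibniz_lie]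
    exact add_mem (LieSubalgebra.lie_mem _ ihy hz) (LieSubalgebra.lie_mem _ hy ihz)

/-- An ideal `W` contains all brackets as soon as it contains the brackets of generators. -/
theorem lie_mem_of_lie_generators {s : Set L} (hs : LieSubalgebra.lieSpan F L s = ⊤)
    {W : Submodule F L} (hW : ∀ x w : L, w ∈ W → ⁅x, w⁆ ∈ W)
    (hss : ∀ x ∈ s, ∀ y ∈ s, ⁅x, y⁆ ∈ W) (x y : L) : ⁅x, y⁆ ∈ W := by
  have key : ∀ z : L, (∀ y ∈ s, ⁅z, y⁆ ∈ W) → ∀ y, ⁅z, y⁆ ∈ W := by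
    intro z hz y
    have hy : y ∈ LieSubalgebra.lieSpan F L s := hs ▸ LieSubalgebra.mem_top y
    induction hy using LieSubalgebra.lieSpan_induction with
    | mem y hy => exact hz y hy
    | zero => simp
    | add y z _ _ ihy ihz => rw [lie_add]; exact add_mem ihy ihz
    | smul a y _ ih => rw [lie_smul]; exact W.smul_mem a ih
    | lie y y' _ _ ihy ihy' =>
      rw [leibniz_lie, ← lie_skew]
      exact add_mem (neg_mem (hW _ _ ihy)) (hW _ _ ihy')
  refine key x (fun y hy => ?_) y
  rw [← lie_skew]
  exact neg_mem (key y (fun z hz => hss y hy z hz) x)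

end LieSpan

namespace BorcherdsLieAlgebra

variable {F g K : Type*} [Field F] [LieRing g] [LieAlgebra F g]
    [Field K] [LinearOrder K] [Algebra K F] {l : ℕ} {A : Matrix (Fin l) (Fin l) K}
    (B : BorcherdsLieAlgebra F g A)

/-- The span of the simple coroots. -/
def corootSpan : Submodule F g :=
  Submodule.span F (Set.range fun i => (B.coroot i : g))

theorem corootSpan_le_cartan : B.corootSpan ≤ B.cartan.toSubmodule := by
  rw [corootSpan, Submodule.span_le]
  rintro _ ⟨i, rfl⟩
  exact (B.coroot i).2

theorem e_mem_plus (i : Fin l) : B.e i ∈ B.plus := LieSubalgebra.subset_lieSpan ⟨i, rfl⟩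

theorem f_mem_minus (i : Fin l) : B.f i ∈ B.minus := LieSubalgebra.subset_lieSpan ⟨i, rfl⟩

theorem lie_cartan_mem_plus {x : g} (hx : x ∈ B.cartan) {y : g} (hy : y ∈ B.plus) :
    ⁅x, y⁆ ∈ B.plus := by
  refine lie_mem_lieSpan ?_ hy
  rintro _ ⟨i, rfl⟩
  rw [B.lie_cartan_e ⟨x, hx⟩ i]
  exact LieSubalgebra.smul_mem _ _ (B.e_mem_plus i)

theorem lie_cartan_mem_minus {x : g} (hx : x ∈ B.cartan) {y : g} (hy : y ∈ B.minus) :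
    ⁅x, y⁆ ∈ B.minus := by
  refine lie_mem_lieSpan ?_ hy
  rintro _ ⟨i, rfl⟩
  rw [B.lie_cartan_f ⟨x, hx⟩ i]
  exact LieSubalgebra.smul_mem _ _ (B.f_mem_minus i)

theorem lie_e_f_mem (i j : Fin l) : ⁅B.e i, B.f j⁆ ∈ B.corootSpan := by
  rcases eq_or_ne i j with rfl | hij
  · rw [B.lie_e_f_same]
    exact Submodule.subset_span ⟨i, rfl⟩
  · rw [B.lie_e_f_ne i j hij]
    exact zero_mem _

theorem lie_e_minus_mem (i : Fin l) {y : g} (hy : y ∈ B.minus) :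
    ⁅B.e i, y⁆ ∈ B.minus.toSubmodule ⊔ B.corootSpan := by
  have hbr : ∀ z ∈ B.minus.toSubmodule ⊔ B.corootSpan, ∀ y ∈ B.minus, ⁅z, y⁆ ∈ B.minus := by
    intro z hz y hy
    obtain ⟨m, hm, d, hd, rfl⟩ := Submodule.mem_sup.1 hz
    rw [add_lie]
    exact add_mem (LieSubalgebra.lie_mem _ hm hy)
      (B.lie_cartan_mem_minus (B.corootSpan_le_cartan hd) hy)
  induction hy using LieSubalgebra.lieSpan_induction with
  | mem y hy =>
    obtain ⟨j, rfl⟩ := hy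
    exact Submodule.mem_sup_right (B.lie_e_f_mem i j)
  | zero => simp
  | add y z _ _ ihy ihz => rw [lie_add]; exact add_mem ihy ihz
  | smul a y _ ih => rw [lie_smul]; exact Submodule.smul_mem _ a ih
  | lie y z hy hz ihy ihz =>
    rw [leibniz_lie, ← lie_skew y]
    exact Submodule.mem_sup_left (add_mem (hbr _ ihy _ hz) (neg_mem (hbr _ ihz _ hy)))

theorem lie_f_plus_mem (i : Fin l) {y : g} (hy : y ∈ B.plus) :
    ⁅B.f i, y⁆ ∈ B.plus.toSubmodule ⊔ B.corootSpan := by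
  have hbr : ∀ z ∈ B.plus.toSubmodule ⊔ B.corootSpan, ∀ y ∈ B.plus, ⁅z, y⁆ ∈ B.plus := by
    intro z hz y hy
    obtain ⟨m, hm, d, hd, rfl⟩ := Submodule.mem_sup.1 hz
    rw [add_lie]
    exact add_mem (LieSubalgebra.lie_mem _ hm hy)
      (B.lie_cartan_mem_plus (B.corootSpan_le_cartan hd) hy)
  induction hy using LieSubalgebra.lieSpan_induction with
  | mem y hy =>
    obtain ⟨j, rfl⟩ := hy
    rw [← lie_skew]
    exact Submodule.mem_sup_right (neg_mem (B.lie_e_f_mem j i))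
  | zero => simp
  | add y z _ _ ihy ihz => rw [lie_add]; exact add_mem ihy ihz
  | smul a y _ ih => rw [lie_smul]; exact Submodule.smul_mem _ a ih
  | lie y z hy hz ihy ihz =>
    rw [leibniz_lie, ← lie_skew y]
    exact Submodule.mem_sup_left (add_mem (hbr _ ihy _ hz) (neg_mem (hbr _ ihz _ hy)))

/-- The derived algebra lies in `𝔤₋ + ∑ F hᵢ + 𝔤₊`: this sum is an ideal, and modulo it `𝔤` is
generated by the image of the abelian algebra `𝔥`. -/
theorem lie_mem_minus_sup_corootSpan_sup_plus (x y : g) :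
    ⁅x, y⁆ ∈ B.minus.toSubmodule ⊔ B.corootSpan ⊔ B.plus.toSubmodule := by
  set W := B.minus.toSubmodule ⊔ B.corootSpan ⊔ B.plus.toSubmodule with hW
  have hm : B.minus.toSubmodule ≤ W := le_sup_left.trans le_sup_left
  have hd : B.corootSpan ≤ W := le_sup_right.trans le_sup_left
  have hp : B.plus.toSubmodule ≤ W := le_sup_right
  have hideal : ∀ x w : g, w ∈ W → ⁅x, w⁆ ∈ W := by
    refine fun x w => lie_mem_of_generators B.generate ?_ x
    have hsup : ∀ x : g, (∀ m ∈ B.minus, ⁅x, m⁆ ∈ W) → (∀ d ∈ B.corootSpan, ⁅x, d⁆ ∈ W) →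
        (∀ p ∈ B.plus, ⁅x, p⁆ ∈ W) → ∀ w ∈ W, ⁅x, w⁆ ∈ W := by
      intro x h1 h2 h3 w hw
      obtain ⟨v, hv, p, hp, rfl⟩ := Submodule.mem_sup.1 hw
      obtain ⟨m, hm, d, hd, rfl⟩ := Submodule.mem_sup.1 hv
      rw [lie_add, lie_add]
      exact add_mem (add_mem (h1 m hm) (h2 d hd)) (h3 p hp)
    rintro x ((hx | ⟨i, rfl⟩) | ⟨i, rfl⟩)
    · refine hsup x (fun m h => hm (B.lie_cartan_mem_minus hx h)) (fun d h => ?_)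
        (fun p h => hp (B.lie_cartan_mem_plus hx h))
      rw [B.cartan_abelian x hx d (B.corootSpan_le_cartan h)]
      exact zero_mem _
    · refine hsup _ (fun m h => sup_le hm hd (B.lie_e_minus_mem i h)) (fun d h => ?_)
        (fun p h => hp (LieSubalgebra.lie_mem _ (B.e_mem_plus i) h))
      rw [← lie_skew]
      exact neg_mem (hp (B.lie_cartan_mem_plus (B.corootSpan_le_cartan h) (B.e_mem_plus i)))
    · refine hsup _ (fun m h => hm (LieSubalgebra.lie_mem _ (B.f_mem_minus i) h)) (fun d h => ?_)
        (fun p h => sup_le hp hd (B.lie_f_plus_mem i h))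
      rw [← lie_skew]
      exact neg_mem (hm (B.lie_cartan_mem_minus (B.corootSpan_le_cartan h) (B.f_mem_minus i)))
  have hright : ∀ x w : g, w ∈ W → ⁅w, x⁆ ∈ W := fun x w hw => by
    rw [← lie_skew]
    exact neg_mem (hideal x w hw)
  refine lie_mem_of_lie_generators B.generate hideal ?_ x y
  rintro x ((hx | ⟨i, rfl⟩) | ⟨i, rfl⟩) y hy
  · rcases hy with (hy | ⟨j, rfl⟩) | ⟨j, rfl⟩
    · rw [B.cartan_abelian x hx y hy]
      exact zero_mem _
    · exact hideal _ _ (hp (B.e_mem_plus j))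
    · exact hideal _ _ (hm (B.f_mem_minus j))
  · exact hright _ _ (hp (B.e_mem_plus i))
  · exact hright _ _ (hm (B.f_mem_minus i))

/-- A Lie subalgebra generated by homogeneous elements of degrees in an additive subsemigroup `D`
lies in the sum of the graded pieces of degree in `D`. -/
theorem lieSpan_le_iSup_grading {s : Set g} (D : AddSubsemigroup (Fin l → ℤ))
    (hs : ∀ x ∈ s, ∃ d ∈ D, x ∈ B.grading d) :
    (LieSubalgebra.lieSpan F g s).toSubmodule ≤ ⨆ d ∈ D, B.grading d := by
  have hle : ∀ d ∈ D, B.grading d ≤ ⨆ d ∈ D, B.grading d := fun d hd =>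
    le_iSup₂_of_le d hd le_rfl
  have hbr : ∀ x ∈ ⨆ d ∈ D, B.grading d, ∀ y ∈ ⨆ d ∈ D, B.grading d,
      ⁅x, y⁆ ∈ ⨆ d ∈ D, B.grading d := by
    have := B.grading_bracket
    have h1 : (⨆ d ∈ D, B.grading d) ≤ ⨅ y : ↥(⨆ d ∈ D, B.grading d),
        (⨆ d ∈ D, B.grading d).comap (-(LieAlgebra.ad F g (y : g)) : g →ₗ[F] g) := by
      refine iSup₂_le fun d hd x hx => ?_
      rw [Submodule.mem_iInf]
      rintro ⟨y, hy⟩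
      have h2 : (⨆ d ∈ D, B.grading d) ≤
          (⨆ d ∈ D, B.grading d).comap (LieAlgebra.ad F g x : g →ₗ[F] g) := by
        refine iSup₂_le fun d' hd' y hy => ?_
        exact hle _ (D.add_mem hd hd') (SetLike.GradedBracket.bracket_mem hx hy)
      have := h2 hy
      rw [Submodule.mem_comap, LieAlgebra.ad_apply] at this
      rwa [Submodule.mem_comap, LinearMap.neg_apply, LieAlgebra.ad_apply, lie_skew]
    intro x hx y hy
    have := (Submodule.mem_iInf _).1 (h1 hx) ⟨y, hy⟩
    rwa [Submodule.mem_comap, LinearMap.neg_apply, LieAlgebra.ad_apply, lie_skew] at this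
  intro x hx
  replace hx : x ∈ LieSubalgebra.lieSpan F g s := hx
  induction hx using LieSubalgebra.lieSpan_induction with
  | mem x hx => obtain ⟨d, hd, h⟩ := hs x hx; exact hle d hd h
  | zero => exact zero_mem _
  | add y z _ _ ihy ihz => exact add_mem ihy ihz
  | smul a y _ ih => exact Submodule.smul_mem _ a ih
  | lie y z _ _ ihy ihz => exact hbr _ ihy _ ihz

theorem plus_le_iSup_grading : B.plus.toSubmodule ≤ ⨆ d ≠ 0, B.grading d := by
  let D : AddSubsemigroup (Fin l → ℤ) :=
    { carrier := {d | 0 < ∑ i, d i}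
      add_mem' := fun {a b} ha hb => by
        simp only [Set.mem_ofPred_eq, Pi.add_apply, Finset.sum_add_distrib] at *
        exact add_pos ha hb }
  refine (B.lieSpan_le_iSup_grading D ?_).trans (biSup_mono fun d (hd : 0 < ∑ i, d i) h => ?_)
  · rintro _ ⟨i, rfl⟩
    exact ⟨_, by simp [D], B.e_mem_grading i⟩
  · simp [h] at hd

theorem minus_le_iSup_grading : B.minus.toSubmodule ≤ ⨆ d ≠ 0, B.grading d := by
  let D : AddSubsemigroup (Fin l → ℤ) :=
    { carrier := {d | ∑ i, d i < 0}
      add_mem' := fun {a b} ha hb => by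
        simp only [Set.mem_ofPred_eq, Pi.add_apply, Finset.sum_add_distrib] at *
        exact add_neg ha hb }
  refine (B.lieSpan_le_iSup_grading D ?_).trans (biSup_mono fun d (hd : ∑ i, d i < 0) h => ?_)
  · rintro _ ⟨i, rfl⟩
    exact ⟨_, by simp [D], B.f_mem_grading i⟩
  · simp [h] at hd

/-- `𝔥 ∩ [𝔤, 𝔤]` is spanned by simple coroots, because `𝔤₊` and `𝔤₋` have no component of degree
zero. -/
theorem cartanDerived_le_corootSpan : B.cartanDerived ≤ B.corootSpan := by
  rintro x ⟨hxc, hx⟩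
  have hxW : x ∈ B.minus.toSubmodule ⊔ B.corootSpan ⊔ B.plus.toSubmodule := by
    have hle : (⁅(⊤ : LieIdeal F g), (⊤ : LieIdeal F g)⁆ : LieIdeal F g).toSubmodule ≤
        B.minus.toSubmodule ⊔ B.corootSpan ⊔ B.plus.toSubmodule := by
      rw [LieSubmodule.lieIdeal_oper_eq_linear_span', Submodule.span_le]
      rintro _ ⟨a, -, b, -, rfl⟩
      exact B.lie_mem_minus_sup_corootSpan_sup_plus a b
    exact hle hx
  obtain ⟨v, hv, p, hp, rfl⟩ := Submodule.mem_sup.1 hxW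
  obtain ⟨m, hm, d, hd, rfl⟩ := Submodule.mem_sup.1 hv
  have hdis : Disjoint (B.grading 0) (⨆ d ≠ 0, B.grading d) :=
    B.grading_internal.submodule_iSupIndep 0
  have h0 : m + p ∈ B.grading 0 := by
    have := B.cartan_le_grading_zero (sub_mem hxc (B.corootSpan_le_cartan hd))
    convert this using 1
    abel
  have := Submodule.disjoint_def.1 hdis _ h0
    (add_mem (B.minus_le_iSup_grading hm) (B.plus_le_iSup_grading hp))
  have hx : m + d + p = d := by
    rw [show m + d + p = m + p + d by abel, this, zero_add]
  rw [hx]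
  exact hd

end BorcherdsLieAlgebra

/-! ### The enveloping algebra of a Borcherds Lie algebra -/

section Enveloping

attribute [local instance 100] LieRing.ofAssociativeRing

variable {F L : Type*} [Field F] [LieRing L] [LieAlgebra F L]

theorem ι_mul (x y : L) :
    UniversalEnvelopingAlgebra.ι F x * UniversalEnvelopingAlgebra.ι F y =
      UniversalEnvelopingAlgebra.ι F y * UniversalEnvelopingAlgebra.ι F x +
        UniversalEnvelopingAlgebra.ι F ⁅x, y⁆ := by
  rw [LieHom.map_lie, LieRing.of_associative_ring_bracket]
  abel

theorem ι_lieSpan_mem (s : Set L) {x : L} (hx : x ∈ LieSubalgebra.lieSpan F L s) :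
    UniversalEnvelopingAlgebra.ι F x ∈ adjoinSub F (UniversalEnvelopingAlgebra.ι F '' s) := by
  induction hx using LieSubalgebra.lieSpan_induction with
  | mem x hx => exact mem_adjoinSub_of_mem ⟨x, hx, rfl⟩
  | zero => rw [map_zero]; exact zero_mem _
  | add y z _ _ ihy ihz => rw [map_add]; exact add_mem ihy ihz
  | smul a y _ ih => rw [map_smul]; exact Submodule.smul_mem _ a ih
  | lie y z _ _ ihy ihz =>
    rw [LieHom.map_lie, LieRing.of_associative_ring_bracket]
    exact sub_mem (mul_mem_adjoinSub ihy ihz) (mul_mem_adjoinSub ihz ihy)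

theorem adjoinSub_ι_le_envelopingSub {s : Set L} {t : LieSubalgebra F L} (hs : s ⊆ t) :
    adjoinSub F (UniversalEnvelopingAlgebra.ι F '' s) ≤ envelopingSub F t := by
  refine Subalgebra.toSubmodule.monotone (Algebra.adjoin_le ?_)
  rintro _ ⟨x, hx, rfl⟩
  exact ⟨UniversalEnvelopingAlgebra.ι F (⟨x, hs hx⟩ : t),
    UniversalEnvelopingAlgebra.lift_ι_apply F _ _⟩

theorem adjoinSub_range_ι :
    adjoinSub F (Set.range (UniversalEnvelopingAlgebra.ι F (L := L))) = ⊤ := by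
  set S := Algebra.adjoin F (Set.range (UniversalEnvelopingAlgebra.ι F (L := L))) with hS
  let φ : L →ₗ⁅F⁆ S :=
    { toFun := fun x => ⟨UniversalEnvelopingAlgebra.ι F x, Algebra.subset_adjoin ⟨x, rfl⟩⟩
      map_add' := fun x y => Subtype.ext (map_add _ x y)
      map_smul' := fun a x => Subtype.ext (map_smul _ a x)
      map_lie' := fun {x y} => Subtype.ext (LieHom.map_lie _ x y) }
  have h : S.val.comp (UniversalEnvelopingAlgebra.lift F φ) = AlgHom.id F _ := by
    refine UniversalEnvelopingAlgebra.hom_ext F (LieHom.ext fun x => ?_)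
    change ((UniversalEnvelopingAlgebra.lift F φ (UniversalEnvelopingAlgebra.ι F x) : S) :
      UniversalEnvelopingAlgebra F L) = UniversalEnvelopingAlgebra.ι F x
    rw [UniversalEnvelopingAlgebra.lift_ι_apply]
    rfl
  refine eq_top_iff.2 fun x _ => ?_
  have hx : ((UniversalEnvelopingAlgebra.lift F φ x : S) : UniversalEnvelopingAlgebra F L) = x :=
    DFunLike.congr_fun h x
  rw [← hx]
  exact (UniversalEnvelopingAlgebra.lift F φ x).2

theorem adjoinSub_ι_eq_top {s : Set L} (hs : LieSubalgebra.lieSpan F L s = ⊤) :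
    adjoinSub F (UniversalEnvelopingAlgebra.ι F '' s) = ⊤ := by
  rw [eq_top_iff, ← adjoinSub_range_ι]
  refine Subalgebra.toSubmodule.monotone (Algebra.adjoin_le ?_)
  rintro _ ⟨x, rfl⟩
  exact ι_lieSpan_mem s (hs ▸ LieSubalgebra.mem_top x)

namespace BorcherdsLieAlgebra

variable {F g K : Type*} [Field F] [LieRing g] [LieAlgebra F g]
    [Field K] [LinearOrder K] [Algebra K F] {l : ℕ} {A : Matrix (Fin l) (Fin l) K}
    (B : BorcherdsLieAlgebra F g A)

theorem isChevalleySystem :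
    IsChevalleySystem F (UniversalEnvelopingAlgebra.ι F '' (B.cartan : Set g))
      (fun i => UniversalEnvelopingAlgebra.ι F (B.coroot i : g))
      (fun i => UniversalEnvelopingAlgebra.ι F (B.e i))
      (fun i => UniversalEnvelopingAlgebra.ι F (B.f i)) where
  commute := by
    rintro _ ⟨x, hx, rfl⟩ _ ⟨y, hy, rfl⟩
    rw [commute_iff_eq, ι_mul, B.cartan_abelian x hx y hy, map_zero, add_zero]
  coroot_mem i := ⟨_, (B.coroot i).2, rfl⟩
  weight_e := by
    rintro _ ⟨x, hx, rfl⟩ i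
    exact ⟨B.root i ⟨x, hx⟩, by rw [ι_mul, B.lie_cartan_e ⟨x, hx⟩ i, map_smul]⟩
  weight_f := by
    rintro _ ⟨x, hx, rfl⟩ i
    exact ⟨-B.root i ⟨x, hx⟩, by rw [ι_mul, B.lie_cartan_f ⟨x, hx⟩ i, map_smul]⟩
  e_mul_f i := by rw [ι_mul, B.lie_e_f_same]
  e_mul_f_ne i j hij := by rw [ι_mul, B.lie_e_f_ne i j hij, map_zero, add_zero]

end BorcherdsLieAlgebra

end Enveloping

attribute [local instance 100] LieRing.ofAssociativeRing in
/-- The triangular product already exhausts `U(𝔤)` when only a complement of `𝔥'` in `𝔥` and the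
simple coroots are used in the middle. -/
theorem BorcherdsLieAlgebra.triangularProduct_eq_top {F g K : Type*} [Field F] [LieRing g]
    [LieAlgebra F g] [Field K] [LinearOrder K] [Algebra K F] {l : ℕ}
    {A : Matrix (Fin l) (Fin l) K} (B : BorcherdsLieAlgebra F g A) {c : LieSubalgebra F g}
    (hc : B.IsCartanComplement c) :
    triangularProduct F (fun i => UniversalEnvelopingAlgebra.ι F (B.e i))
      (fun i => UniversalEnvelopingAlgebra.ι F (B.f i))
      (UniversalEnvelopingAlgebra.ι F '' (c : Set g) ∪
        Set.range fun i => UniversalEnvelopingAlgebra.ι F (B.coroot i : g)) = ⊤ := by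
  set S : Set (UniversalEnvelopingAlgebra F g) := UniversalEnvelopingAlgebra.ι F '' (c : Set g) ∪
    Set.range fun i => UniversalEnvelopingAlgebra.ι F (B.coroot i : g) with hS
  have hH : adjoinSub F (UniversalEnvelopingAlgebra.ι F '' (B.cartan : Set g)) ≤ adjoinSub F S := by
    refine Subalgebra.toSubmodule.monotone (Algebra.adjoin_le ?_)
    rintro _ ⟨x, hx, rfl⟩
    have hx' : x ∈ c.toSubmodule ⊔ B.cartanDerived := hc.2 ▸ hx
    obtain ⟨y, hy, z, hz, rfl⟩ := Submodule.mem_sup.1 hx'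
    rw [map_add]
    refine add_mem (mem_adjoinSub_of_mem (F := F) (Or.inl ⟨y, hy, rfl⟩)) ?_
    have hle : B.corootSpan ≤ (adjoinSub F S).comap
        (UniversalEnvelopingAlgebra.ι F (L := g)).toLinearMap := by
      rw [BorcherdsLieAlgebra.corootSpan, Submodule.span_le]
      rintro _ ⟨i, rfl⟩
      exact mem_adjoinSub_of_mem (F := F) (Or.inr ⟨i, rfl⟩)
    exact hle (B.cartanDerived_le_corootSpan hz)
  have htop := adjoinSub_ι_eq_top B.generate
  rw [Set.image_union, Set.image_union, ← Set.range_comp, ← Set.range_comp] at htop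
  rw [eq_top_iff, ← htop]
  exact B.isChevalleySystem.adjoinSub_le_triangularProduct.trans
    (mul_le_mul_right (mul_le_mul_left hH _) _)

attribute [local instance 100] LieRing.ofAssociativeRing in
/-- The products are products of linear subspaces of `U(g)` (the span of the products of elements),
and the factors for `i ∈ I` and for `j ∈ J` are taken in any given orders. -/
theorem proposition3p1 {K F g : Type*} [Field K] [LinearOrder K] [IsStrictOrderedRing K]
    [Field F] [CharZero F] [Algebra K F] [LieRing g] [LieAlgebra F g]
    {l : ℕ} {A : Matrix (Fin l) (Fin l) K} (B : BorcherdsLieAlgebra F g A)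
    (I J : Finset (Fin l)) (hdisj : Disjoint I J) (hunion : I ∪ J = Finset.univ)
    (orderI orderJ : List (Fin l)) (hInodup : orderI.Nodup) (hI : orderI.toFinset = I)
    (hJnodup : orderJ.Nodup) (hJ : orderJ.toFinset = J)
    (h'' : LieSubalgebra F g) (hcompl : B.IsCartanComplement h'') :
    (orderI.map fun i => envelopingSub F (lieLine F (B.e i))).prod
        * envelopingSub F B.minus * envelopingSub F h'' * envelopingSub F B.plus
        * (orderJ.map fun j => envelopingSub F (lieLine F (B.f j))).prod
      = ⊤ := by
  have C := B.isChevalleySystem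
  have hS : UniversalEnvelopingAlgebra.ι F '' (h'' : Set g) ⊆
      UniversalEnvelopingAlgebra.ι F '' (B.cartan : Set g) :=
    Set.image_mono fun x hx => (hcompl.2 ▸ Submodule.mem_sup_left hx :
      x ∈ B.cartan.toSubmodule)
  have hline : ∀ x : g, adjoinSub F {UniversalEnvelopingAlgebra.ι F x} ≤
      envelopingSub F (lieLine F x) := fun x => by
    have := adjoinSub_ι_le_envelopingSub (F := F) (s := {x}) (t := lieLine F x)
      (Set.singleton_subset_iff.2 (Submodule.mem_span_singleton_self x))
    rwa [Set.image_singleton] at this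
  have hprod : ∀ (o : List (Fin l)) (x : Fin l → g),
      (o.map fun i => adjoinSub F {UniversalEnvelopingAlgebra.ι F (x i)}).prod ≤
        (o.map fun i => envelopingSub F (lieLine F (x i))).prod := fun o x => by
    induction o with
    | nil => exact le_rfl
    | cons i o ih =>
      rw [List.map_cons, List.prod_cons, List.map_cons, List.prod_cons]
      exact mul_le_mul' (hline _) ih
  have hminus : adjoinSub F (Set.range fun i => UniversalEnvelopingAlgebra.ι F (B.f i)) ≤
      envelopingSub F B.minus := by
    rw [← Function.comp_def, Set.range_comp]
    exact adjoinSub_ι_le_envelopingSub LieSubalgebra.subset_lieSpan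
  have hplus : adjoinSub F (Set.range fun i => UniversalEnvelopingAlgebra.ι F (B.e i)) ≤
      envelopingSub F B.plus := by
    rw [← Function.comp_def, Set.range_comp]
    exact adjoinSub_ι_le_envelopingSub LieSubalgebra.subset_lieSpan
  have hcover : UniversalEnvelopingAlgebra.ι F '' (h'' : Set g) ∪
      Set.range (fun i => UniversalEnvelopingAlgebra.ι F (B.coroot i : g)) ⊆
      (UniversalEnvelopingAlgebra.ι F '' (h'' : Set g) ∪
        (fun i => UniversalEnvelopingAlgebra.ι F (B.coroot i : g)) '' {i | i ∈ orderJ}) ∪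
        (fun i => UniversalEnvelopingAlgebra.ι F (B.coroot i : g)) '' {i | i ∈ orderI} := by
    rintro x (hx | ⟨i, rfl⟩)
    · exact Or.inl (Or.inl hx)
    · have hi : i ∈ I ∪ J := hunion ▸ Finset.mem_univ i
      rcases Finset.mem_union.1 hi with hi | hi
      · exact Or.inr ⟨i, List.mem_toFinset.1 (hI ▸ hi), rfl⟩
      · exact Or.inl (Or.inr ⟨i, List.mem_toFinset.1 (hJ ▸ hi), rfl⟩)
  have hSJ : UniversalEnvelopingAlgebra.ι F '' (h'' : Set g) ∪
      (fun i => UniversalEnvelopingAlgebra.ι F (B.coroot i : g)) '' {i | i ∈ orderJ} ⊆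
      UniversalEnvelopingAlgebra.ι F '' (B.cartan : Set g) :=
    Set.union_subset hS (by rintro _ ⟨j, -, rfl⟩; exact C.coroot_mem j)
  have htop := B.triangularProduct_eq_top hcompl
  rw [eq_top_iff] at htop ⊢
  refine (htop.trans (mul_le_mul_right (mul_le_mul_left
    (Subalgebra.toSubmodule.monotone (Algebra.adjoin_mono hcover)) _) _)).trans ?_
  refine (C.triangularProduct_union_le_left hSJ orderI).trans ?_
  refine (mul_le_mul_right (C.triangularProduct_union_le_right hS orderJ) _).trans ?_
  simp only [triangularProduct, mul_assoc]
  exact mul_le_mul' (hprod orderI B.e) (mul_le_mul' hminus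
    (mul_le_mul' (adjoinSub_ι_le_envelopingSub subset_rfl)
      (mul_le_mul' hplus (hprod orderJ B.f))))
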